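/- Throughout, for a simple graph $G$, $N(x)$ is the neighbourhood of $x$, $d(\cdot,\cdot)$ is the graph distance, and an end vertex is a vertex of degree $1$; for vertices $a,b,c$ let $C(a,b)=\{x : N(x)=\{a,b\}\}$, let $T_a$ be the set of end vertices adjacent to $a$, let $B=\{x : x\notin C(a,b),\ d(c,x)=2\}$ and $W=\{x : d(c,x)=3\}$. For a commutative semigroup $S$ with $0$, $\Gamma(S)$ is the graph whose vertices are the nonzero zero-divisors of $S$, two distinct vertices $x,y$ being adjacent iff $xy=0$; a graph $G$ is a *semigroup graph* if $G\cong\Gamma(S)$ for some commutative semigroup $S$ with $0$. **Theorem.** Let $G$ be a connected simple graph (of any finite or infinite cardinality) of diameter $3$. Let $a,b$ be adjacent vertices, $c_1\in C(a,b)$, and $w$ a vertex with $d(c_1,w)=3$; form $B$ and $W$ with $c=c_1$, and assume $|B\setminus(T_a\cup T_b)|=1$. Then $G$ is a semigroup graph if and only if all of the following hold: 1. $C(a,b)$ and $W$ are nonempty (of any cardinality), and $W$ consists of end vertices; 2. $T_a=\emptyset$ or $T_b=\emptyset$; 3. the unique vertex of $B\setminus(T_a\cup T_b)$ is adjacent to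 both $a$ and $b$. Equivalently, $G$ is a semigroup graph if and only if it is isomorphic, by an isomorphism carrying $\{a,b\}$ to the pair $\{a,b\}$ of the model (possibly interchanging the two), to a graph of the following form: a triangle on vertices $a,b,d$, together with a nonempty set of further vertices each adjacent to exactly $a$ and $b$, a possibly empty set $U$ of end vertices adjacent to $a$, and a nonempty set of end vertices adjacent to $d$; the cardinalities of these three sets may be arbitrary, finite or infinite. -/

import Mathlib

universe u

/-- A commutative semigroup with an absorbing element `0`. -/
class CommSemigroupWithZero (S : Type u) extends CommSemigroup S, SemigroupWithZero S

namespace ZeroDivGraph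

/-- The vertices of `Γ(S)`: the nonzero zero-divisors of `S`. -/
def Vertex (S : Type u) [CommSemigroupWithZero S] : Type u :=
  {x : S // x ≠ 0 ∧ ∃ y : S, y ≠ 0 ∧ x * y = 0}

/-- The zero-divisor graph `Γ(S)` of a commutative semigroup with zero: two distinct nonzero
zero-divisors are adjacent when their product is `0`. -/
def zeroDivisorGraph (S : Type u) [CommSemigroupWithZero S] : SimpleGraph (Vertex S) where
  Adj x y := x ≠ y ∧ x.1 * y.1 = 0
  symm := ⟨fun x y h => ⟨h.1.symm, by rw [mul_comm]; exact h.2⟩⟩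
  loopless := ⟨fun _ h => h.1 rfl⟩

/-- `G` is a semigroup graph: it is isomorphic to `Γ(S)` for some commutative semigroup `S`
with zero. (The nonzero zero-divisors together with `0` form a subsemigroup with the same graph,
so restricting `S` to the universe of the vertex type loses nothing.) -/
def IsSemigroupGraph {V : Type u} (G : SimpleGraph V) : Prop :=
  ∃ (S : Type u) (_ : CommSemigroupWithZero S), Nonempty (G ≃g zeroDivisorGraph S)

variable {V : Type u} (G : SimpleGraph V)

/-- An end vertex: a vertex of degree `1`. -/
def IsEndVertex (x : V) : Prop := (G.neighborSet x).encard = 1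

/-- `C(a, b)`: the vertices whose neighborhood is exactly `{a, b}`. -/
def capSet (a b : V) : Set V := {x | G.neighborSet x = {a, b}}

/-- `T_a`: the end vertices adjacent to `a`. -/
def endSet (a : V) : Set V := {x | G.Adj a x ∧ IsEndVertex G x}

/-- `B`: the vertices outside `C(a, b)` at distance `2` from the chosen `c ∈ C(a, b)`. -/
def levelTwo (a b c : V) : Set V := {x | x ∉ capSet G a b ∧ G.dist c x = 2}

/-- `W`: the vertices at distance `3` from `c`. -/
def levelThree (c : V) : Set V := {x | G.dist c x = 3}

/-- The vertices of the model graph: three vertices `a, b, d` and four families. -/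
inductive ModelVertex (C U V W : Type u) : Type u
  | a : ModelVertex C U V W
  | b : ModelVertex C U V W
  | d : ModelVertex C U V W
  | c (i : C) : ModelVertex C U V W
  | u (i : U) : ModelVertex C U V W
  | v (i : V) : ModelVertex C U V W
  | w (i : W) : ModelVertex C U V W

/-- The edges of the model graph, each listed in one orientation. -/
def modelRel {C U V W : Type u} : ModelVertex C U V W → ModelVertex C U V W → Prop
  | .a, .b => True
  | .a, .d => True
  | .b, .d => True
  | .c _, .a => True
  | .c _, .b => True
  | .u _, .a => True
  | .v _, .b => True
  | .w _, .d => True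
  | _, _ => False

/-- The model graph: a triangle `a, b, d`; a family `C` of vertices adjacent to exactly `a` and
`b`; and families `U`, `V`, `W` of end vertices adjacent to `a`, `b`, `d` respectively. -/
def modelGraph (C U V W : Type u) : SimpleGraph (ModelVertex C U V W) :=
  SimpleGraph.fromRel modelRel

end ZeroDivGraph

/-! Since `N(c) = {a, b}` and `d` is the only exceptional vertex at distance `2`, all of `W` hangs
on `d` (`exists_isLayered`). The undetermined data are the edges `ad`, `bd`, the edges inside `W`,
and which of `T_a`, `T_b` are empty.

Necessity. A nonzero product of vertices is annihilated by every annihilator of either factor, so it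
is a vertex whose position is known. If `s`, `t` are at distance above `2`, neighbours of `s` and
`t` multiply to zero (`mul_eq_zero_of_dist`); with `s = c` and `t` in `W` this gives `ad`, `bd` and
no edge inside `W`. If `p ∈ T_a` and `q ∈ T_b` both existed, then `pw = b`, `qw = a` and `pq = d`,
with `a`, `b`, `d` idempotent. But `cw` is nonzero and annihilated by all three, which forces it to
be one of them: a contradiction.

Sufficiency. The layers identify `G` with the model graph, which is realized by an explicit
semigroup on two generators, blown up to arbitrary cardinalities. -/

open ZeroDivGraph

namespace ZeroDivGraph

/-! ### A semigroup realizing the model graph -/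

section Model

variable {C U V W : Type u}

/-- The multiplication of the semigroup generated by `u` and `w` subject to `u ^ 4 = u ^ 3`,
`w ^ 2 = w`, `u ^ 3 * w = 0`, where `c = u ^ 2`, `d = u ^ 3`, `b = u * w`, `a = u ^ 2 * w`, and where
`u`, `c` and `w` are blown up to the families `U`, `C` and `W`. -/
def modelMul (c₀ : C) (w₀ : W) : ModelVertex C U V W → ModelVertex C U V W →
    Option (ModelVertex C U V W)
  | .u _, .u _ => some (.c c₀)
  | .u _, .c _ => some .d
  | .c _, .u _ => some .d
  | .u _, .d => some .d
  | .d, .u _ => some .d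
  | .u _, .b => some .a
  | .b, .u _ => some .a
  | .u _, .w _ => some .b
  | .w _, .u _ => some .b
  | .c _, .c _ => some .d
  | .c _, .d => some .d
  | .d, .c _ => some .d
  | .d, .d => some .d
  | .c _, .w _ => some .a
  | .w _, .c _ => some .a
  | .b, .b => some .a
  | .w _, .a => some .a
  | .a, .w _ => some .a
  | .w _, .b => some .b
  | .b, .w _ => some .b
  | .w _, .w _ => some (.w w₀)
  | _, _ => none

/-- The model vertices together with a zero form a commutative semigroup. -/
@[reducible] def modelSemigroup (c₀ : C) (w₀ : W) :
    CommSemigroupWithZero (Option (ModelVertex C U V W)) where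
  mul x y := x.bind fun x => y.bind fun y => modelMul c₀ w₀ x y
  zero := none
  zero_mul _ := rfl
  mul_zero x := by cases x <;> rfl
  mul_comm x y := by
    rcases x with _ | x <;> rcases y with _ | y <;> try rfl
    cases x <;> cases y <;> rfl
  mul_assoc x y z := by
    rcases x with _ | x
    · rfl
    rcases y with _ | y
    · rfl
    rcases z with _ | z
    · change Option.bind (modelMul c₀ w₀ x y) (fun _ => none) = none
      cases modelMul c₀ w₀ x y <;> rfl
    -- A product depends only on the families of its factors, not on the indices, so each case is a
    -- closed computation.
    cases x <;> cases y <;> cases z <;> rfl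

theorem isSemigroupGraph_modelGraph [hC : Nonempty C] [hW : Nonempty W] [IsEmpty V] :
    IsSemigroupGraph (modelGraph C U V W) := by
  obtain ⟨c₀⟩ := hC
  obtain ⟨w₀⟩ := hW
  let inst := modelSemigroup (U := U) (V := V) c₀ w₀
  have hdiv : ∀ x : ModelVertex C U V W, (some x : Option (ModelVertex C U V W)) ≠ 0 ∧
      ∃ y : Option (ModelVertex C U V W), y ≠ 0 ∧ some x * y = 0 := by
    have hne : ∀ x : ModelVertex C U V W, (some x : Option (ModelVertex C U V W)) ≠ 0 :=
      fun x => Option.some_ne_none x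
    intro x
    refine ⟨hne x, ?_⟩
    cases x with
    -- The element `a` annihilates everything except the `w i`, and these are annihilated by `d`.
    | a => exact ⟨some .b, hne _, rfl⟩
    | b => exact ⟨some .a, hne _, rfl⟩
    | d => exact ⟨some .a, hne _, rfl⟩
    | c i => exact ⟨some .a, hne _, rfl⟩
    | u i => exact ⟨some .a, hne _, rfl⟩
    | v i => exact isEmptyElim i
    | w i => exact ⟨some .d, hne _, rfl⟩
  let e : ModelVertex C U V W ≃ Vertex (Option (ModelVertex C U V W)) :=
    { toFun := fun x => ⟨some x, hdiv x⟩
      invFun := fun s => s.1.get (Option.ne_none_iff_isSome.1 s.2.1)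
      left_inv := fun x => rfl
      right_inv := fun s => Subtype.ext (Option.some_get _) }
  refine ⟨Option (ModelVertex C U V W), inst, ⟨e, ?_⟩⟩
  intro x y
  have hmul : ((e x).1 * (e y).1 = 0) ↔ modelMul c₀ w₀ x y = none := Iff.rfl
  change (e x ≠ e y ∧ (e x).1 * (e y).1 = 0) ↔ _
  rw [hmul, e.injective.ne_iff, modelGraph, SimpleGraph.fromRel_adj]
  refine and_congr_right fun hne => ?_
  cases x <;> cases y <;>
    first | exact isEmptyElim ‹V› | exact absurd rfl hne | simp [modelMul, modelRel]

end Model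

section Iso

theorem IsSemigroupGraph.of_iso {V W : Type u} {G : SimpleGraph V} {H : SimpleGraph W}
    (φ : G ≃g H) (h : IsSemigroupGraph H) : IsSemigroupGraph G := by
  obtain ⟨S, inst, ⟨ψ⟩⟩ := h
  exact ⟨S, inst, ⟨φ.trans ψ⟩⟩

end Iso

/-! ### Distance layers around `c` and comparison with the model -/

section Graph

variable {V : Type u} {G : SimpleGraph V} {a b c d x y : V}

theorem adj_iff_of_mem_capSet (hx : x ∈ capSet G a b) : G.Adj x y ↔ y = a ∨ y = b := by
  rw [← SimpleGraph.mem_neighborSet, show G.neighborSet x = {a, b} from hx]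
  simp

theorem adj_iff_of_mem_endSet (hx : x ∈ endSet G a) : G.Adj x y ↔ y = a := by
  obtain ⟨z, hz⟩ := Set.encard_eq_one.1 hx.2
  have h (t : V) : G.Adj x t ↔ t = z := by
    rw [← SimpleGraph.mem_neighborSet, hz, Set.mem_singleton_iff]
  rw [h, (h a).1 hx.1.symm]

theorem capSet_comm : capSet G a b = capSet G b a := by
  simp only [capSet, Set.pair_comm]

/-- The distance layers around a vertex `c` with neighborhood `{a, b}` when all vertices of the
second layer other than `d` are end vertices or have neighborhood `{a, b}`. -/
structure IsLayered (G : SimpleGraph V) (a b c d : V) : Prop where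
  adj : G.Adj a b
  mem_capSet : c ∈ capSet G a b
  dist_eq : G.dist c d = 2
  notMem_capSet : d ∉ capSet G a b
  notMem_left : d ∉ endSet G a
  notMem_right : d ∉ endSet G b
  cover : ∀ x, x = a ∨ x = b ∨ x = d ∨ x ∈ capSet G a b ∨ x ∈ endSet G a ∨ x ∈ endSet G b ∨
    x ∈ levelThree G c
  adj_levelThree : ∀ x ∈ levelThree G c, G.Adj d x

namespace IsLayered

theorem swap (h : IsLayered G a b c d) : IsLayered G b a c d where
  adj := h.adj.symm
  mem_capSet := capSet_comm (G := G) ▸ h.mem_capSet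
  dist_eq := h.dist_eq
  notMem_capSet := capSet_comm (G := G) ▸ h.notMem_capSet
  notMem_left := h.notMem_right
  notMem_right := h.notMem_left
  cover x := by
    rw [capSet_comm]
    have := h.cover x
    tauto
  adj_levelThree := h.adj_levelThree

theorem adj_left (h : IsLayered G a b c d) : G.Adj c a :=
  (adj_iff_of_mem_capSet h.mem_capSet).2 (.inl rfl)

theorem dist_left (h : IsLayered G a b c d) : G.dist c a = 1 :=
  SimpleGraph.dist_eq_one_iff_adj.2 h.adj_left

theorem ne_left (h : IsLayered G a b c d) : d ≠ a := by
  rintro rfl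
  have := h.dist_left
  have := h.dist_eq
  omega

theorem not_adj_levelThree (h : IsLayered G a b c d) (hx : x ∈ levelThree G c) :
    ¬ G.Adj a x := by
  intro hax
  have h1 : G.dist c x = 3 := hx
  have := SimpleGraph.dist_le (.cons h.adj_left (.cons hax .nil) : G.Walk c x)
  simp at this
  omega

theorem ne_of_mem_levelThree (h : IsLayered G a b c d) (hx : x ∈ levelThree G c) : x ≠ a := by
  rintro rfl
  have h1 : G.dist c x = 3 := hx
  have := h.dist_left
  omega

theorem ne_of_mem_endSet (h : IsLayered G a b c d) (hx : x ∈ endSet G a) : x ≠ b := by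
  rintro rfl
  exact h.adj_left.ne ((adj_iff_of_mem_endSet hx).1 h.swap.adj_left.symm)

theorem notMem_endSet_levelThree (h : IsLayered G a b c d) (hx : x ∈ levelThree G c) :
    x ∉ endSet G a :=
  fun hxa => h.not_adj_levelThree hx hxa.1

theorem notMem_endSet_capSet (h : IsLayered G a b c d) (hx : x ∈ capSet G a b) :
    x ∉ endSet G a :=
  fun hxa => h.adj.ne ((adj_iff_of_mem_endSet hxa).1 ((adj_iff_of_mem_capSet hx).2 (.inr rfl))).symm

theorem notMem_capSet_levelThree (h : IsLayered G a b c d) (hx : x ∈ levelThree G c) :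
    x ∉ capSet G a b :=
  fun hxa => h.not_adj_levelThree hx ((adj_iff_of_mem_capSet hxa).2 (.inl rfl)).symm

/-- The neighbourhoods of `c`-type vertices and of ends at `a` or `b` lie in `{a, b}`, which is too
close to `c` to meet the third layer. -/
theorem eq_or_mem_levelThree (h : IsLayered G a b c d) (hx : x ∈ levelThree G c)
    (hxy : G.Adj x y) : y = d ∨ y ∈ levelThree G c := by
  rcases h.cover y with rfl | rfl | rfl | hy | hy | hy | hy
  · exact absurd hxy.symm (h.not_adj_levelThree hx)
  · exact absurd hxy.symm (h.swap.not_adj_levelThree hx)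
  · exact .inl rfl
  · rcases (adj_iff_of_mem_capSet hy).1 hxy.symm with e | e
    · exact absurd e (h.ne_of_mem_levelThree hx)
    · exact absurd e (h.swap.ne_of_mem_levelThree hx)
  · exact absurd ((adj_iff_of_mem_endSet hy).1 hxy.symm) (h.ne_of_mem_levelThree hx)
  · exact absurd ((adj_iff_of_mem_endSet hy).1 hxy.symm) (h.swap.ne_of_mem_levelThree hx)
  · exact .inr hy

theorem adj_iff_of_mem_levelThree (h : IsLayered G a b c d) (hx : x ∈ levelThree G c)
    (hend : IsEndVertex G x) : G.Adj x y ↔ y = d :=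
  adj_iff_of_mem_endSet ⟨h.adj_levelThree x hx, hend⟩

/-- The map from the model graph determined by the layers. -/
def ofModel (G : SimpleGraph V) (a b c d : V) :
    ModelVertex (capSet G a b) (endSet G a) PEmpty.{u + 1} (levelThree G c) → V
  | .a => a
  | .b => b
  | .d => d
  | .c i => i
  | .u i => i
  | .v i => i.elim
  | .w i => i

theorem ofModel_bijective (h : IsLayered G a b c d) (hb : endSet G b = ∅) :
    Function.Bijective (ofModel G a b c d) := by
  constructor
  · have hCa : ∀ x ∈ capSet G a b, x ≠ a := fun x hx =>
      ((adj_iff_of_mem_capSet hx).2 (.inl rfl)).ne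
    have hCb : ∀ x ∈ capSet G a b, x ≠ b := fun x hx =>
      ((adj_iff_of_mem_capSet hx).2 (.inr rfl)).ne
    have hCd : ∀ x ∈ capSet G a b, x ≠ d := fun x hx e => h.notMem_capSet (e ▸ hx)
    have hUa : ∀ x ∈ endSet G a, x ≠ a := fun x hx => hx.1.ne.symm
    have hUd : ∀ x ∈ endSet G a, x ≠ d := fun x hx e => h.notMem_left (e ▸ hx)
    have hWd : ∀ x ∈ levelThree G c, x ≠ d := fun x hx => (h.adj_levelThree x hx).ne.symm
    have hUb : ∀ x ∈ endSet G a, x ≠ b := fun x hx => h.ne_of_mem_endSet hx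
    have hWa : ∀ x ∈ levelThree G c, x ≠ a := fun x hx => h.ne_of_mem_levelThree hx
    have hWb : ∀ x ∈ levelThree G c, x ≠ b := fun x hx => h.swap.ne_of_mem_levelThree hx
    have hUC : ∀ x ∈ capSet G a b, ∀ y ∈ endSet G a, x ≠ y := fun x hx y hy e =>
      h.notMem_endSet_capSet hx (e ▸ hy)
    have hUW : ∀ x ∈ levelThree G c, ∀ y ∈ endSet G a, x ≠ y := fun x hx y hy e =>
      h.notMem_endSet_levelThree hx (e ▸ hy)
    have hCW : ∀ x ∈ levelThree G c, ∀ y ∈ capSet G a b, x ≠ y := fun x hx y hy e =>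
      h.notMem_capSet_levelThree hx (e ▸ hy)
    have := h.adj.ne
    have := h.ne_left
    have := h.swap.ne_left
    rintro (_ | _ | _ | ⟨x, hx⟩ | ⟨x, hx⟩ | x | ⟨x, hx⟩)
      (_ | _ | _ | ⟨y, hy⟩ | ⟨y, hy⟩ | y | ⟨y, hy⟩) e <;>
      first
        | exact x.elim
        | exact y.elim
        | (simp only [ofModel] at e; grind)
  · intro x
    rcases h.cover x with rfl | rfl | rfl | hx | hx | hx | hx
    · exact ⟨.a, rfl⟩
    · exact ⟨.b, rfl⟩
    · exact ⟨.d, rfl⟩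
    · exact ⟨.c ⟨x, hx⟩, rfl⟩
    · exact ⟨.u ⟨x, hx⟩, rfl⟩
    · simp [hb] at hx
    · exact ⟨.w ⟨x, hx⟩, rfl⟩

theorem adj_ofModel_iff (h : IsLayered G a b c d) (hb : endSet G b = ∅)
    (hW : ∀ s ∈ levelThree G c, IsEndVertex G s) (hda : G.Adj a d) (hdb : G.Adj b d)
    (x y : ModelVertex (capSet G a b) (endSet G a) PEmpty.{u + 1} (levelThree G c)) :
    G.Adj (ofModel G a b c d x) (ofModel G a b c d y) ↔ (modelGraph _ _ _ _).Adj x y := by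
  have hinj := (h.ofModel_bijective hb).injective
  have hA (z) : ofModel G a b c d z = a ↔ z = .a := hinj.eq_iff (b := .a)
  have hB (z) : ofModel G a b c d z = b ↔ z = .b := hinj.eq_iff (b := .b)
  have hD (z) : ofModel G a b c d z = d ↔ z = .d := hinj.eq_iff (b := .d)
  have hc (i z) : G.Adj (ofModel G a b c d (.c i)) (ofModel G a b c d z) ↔ z = .a ∨ z = .b := by
    rw [← hA, ← hB]
    exact adj_iff_of_mem_capSet i.2
  have hu (i z) : G.Adj (ofModel G a b c d (.u i)) (ofModel G a b c d z) ↔ z = .a := by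
    rw [← hA]
    exact adj_iff_of_mem_endSet i.2
  have hw (i z) : G.Adj (ofModel G a b c d (.w i)) (ofModel G a b c d z) ↔ z = .d := by
    rw [← hD]
    exact h.adj_iff_of_mem_levelThree i.2 (hW _ i.2)
  have hab : G.Adj (ofModel G a b c d .a) (ofModel G a b c d .b) := h.adj
  have had : G.Adj (ofModel G a b c d .a) (ofModel G a b c d .d) := hda
  have hbd : G.Adj (ofModel G a b c d .b) (ofModel G a b c d .d) := hdb
  rw [modelGraph, SimpleGraph.fromRel_adj]
  cases x <;> cases y <;>
    first
      | exact PEmpty.elim ‹_›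
      | (simp [modelRel, hc, hu, hw, hab, had, hbd, hab.symm, had.symm, hbd.symm]; done)
      | (rw [SimpleGraph.adj_comm]; simp [modelRel, hc, hu, hw])

theorem exists_iso (h : IsLayered G a b c d) (hb : endSet G b = ∅)
    (hW : ∀ s ∈ levelThree G c, IsEndVertex G s) (hda : G.Adj a d) (hdb : G.Adj b d) :
    ∃ φ : G ≃g modelGraph (capSet G a b) (endSet G a) PEmpty.{u + 1} (levelThree G c),
      φ a = .a ∧ φ b = .b := by
  let e := Equiv.ofBijective _ (h.ofModel_bijective hb)
  let ψ : modelGraph (capSet G a b) (endSet G a) PEmpty.{u + 1} (levelThree G c) ≃g G :=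
    ⟨e, fun {x y} => h.adj_ofModel_iff hb hW hda hdb x y⟩
  exact ⟨ψ.symm, ψ.symm_apply_apply .a, ψ.symm_apply_apply .b⟩

end IsLayered

/-- The penultimate vertex of a geodesic from `c` to a third-layer vertex has distance `2` and a
neighbour outside `{a, b}`; only `d` qualifies. -/
theorem exists_isLayered (hconn : G.Connected) (hdiam : G.diam = 3) (hab : G.Adj a b)
    (hc : c ∈ capSet G a b)
    (hB : levelTwo G a b c \ (endSet G a ∪ endSet G b) = {d}) : IsLayered G a b c d := by
  have hd : d ∈ levelTwo G a b c \ (endSet G a ∪ endSet G b) := hB ▸ rfl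
  have htwo (x : V) (hx : G.dist c x = 2) :
      x = d ∨ x ∈ capSet G a b ∨ x ∈ endSet G a ∨ x ∈ endSet G b := by
    by_contra! hn
    have hmem : x ∈ levelTwo G a b c \ (endSet G a ∪ endSet G b) :=
      ⟨⟨hn.2.1, hx⟩, fun h => h.elim hn.2.2.1 hn.2.2.2⟩
    rw [hB] at hmem
    exact hn.1 hmem
  have hdist {x : V} (hx : x = a ∨ x = b) : G.dist c x = 1 :=
    SimpleGraph.dist_eq_one_iff_adj.2 ((adj_iff_of_mem_capSet hc).2 hx)
  refine ⟨hab, hc, hd.1.2, hd.1.1, fun h => hd.2 (.inl h), fun h => hd.2 (.inr h), ?_, ?_⟩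
  · intro x
    -- An infinite extended diameter would give `diam` its default value `0`, not `3`.
    have htop : G.ediam ≠ ⊤ := by
      intro h
      simp [SimpleGraph.diam, h] at hdiam
    have hle : G.dist c x ≤ 3 := hdiam ▸ SimpleGraph.dist_le_diam htop
    have hcases : G.dist c x = 0 ∨ G.dist c x = 1 ∨ G.dist c x = 2 ∨ G.dist c x = 3 := by omega
    rcases hcases with h | h | h | h
    · rw [hconn.dist_eq_zero_iff] at h
      exact .inr (.inr (.inr (.inl (h ▸ hc))))
    · rw [SimpleGraph.dist_eq_one_iff_adj, adj_iff_of_mem_capSet hc] at h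
      tauto
    · have := htwo x h
      tauto
    · exact .inr (.inr (.inr (.inr (.inr (.inr h)))))
  · intro x hx
    have hx3 : G.dist c x = 3 := hx
    obtain ⟨p, hp⟩ := hconn.exists_walk_length_eq_dist c x
    rw [hx3] at hp
    obtain ⟨y, hyx, q, hq⟩ : ∃ y, ∃ _ : G.Adj y x, ∃ q : G.Walk c y, q.length = 2 := by
      cases p with
      | nil => simp at hp
      | cons h₁ p =>
        cases p with
        | nil => simp at hp
        | cons h₂ p =>
          cases p with
          | nil => simp at hp
          | cons h₃ p =>
            cases p with
            | nil => exact ⟨_, h₃, .cons h₁ (.cons h₂ .nil), rfl⟩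
            | cons h₄ p => simp at hp
    have hy : G.dist c y = 2 := by
      have h1 := SimpleGraph.dist_le q
      have h2 := hconn.dist_triangle (u := c) (v := y) (w := x)
      rw [SimpleGraph.dist_eq_one_iff_adj.2 hyx] at h2
      omega
    have hxab : ¬ (x = a ∨ x = b) := fun h => by
      have := hdist h
      omega
    rcases htwo y hy with rfl | hy | hy | hy
    · exact hyx
    · exact absurd ((adj_iff_of_mem_capSet hy).1 hyx) hxab
    · exact absurd (.inl ((adj_iff_of_mem_endSet hy).1 hyx)) hxab
    · exact absurd (.inr ((adj_iff_of_mem_endSet hy).1 hyx)) hxab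

end Graph

/-! ### Constraints imposed by the multiplication -/

section Labeling

/-- A labeling of the vertices of `G` by the nonzero zero-divisors of `S` that realizes `G` as the
zero-divisor graph of `S`. -/
structure IsLabeling {V S : Type u} [CommSemigroupWithZero S] (G : SimpleGraph V) (m : V → S) :
    Prop where
  ne_zero : ∀ x, m x ≠ 0
  adj_iff : ∀ x y, G.Adj x y ↔ x ≠ y ∧ m x * m y = 0
  exists_eq : ∀ s t : S, s ≠ 0 → t ≠ 0 → s * t = 0 → ∃ x, m x = s

theorem IsSemigroupGraph.exists_isLabeling {V : Type u} {G : SimpleGraph V}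
    (h : IsSemigroupGraph G) :
    ∃ (S : Type u) (_ : CommSemigroupWithZero S) (m : V → S), IsLabeling G m := by
  obtain ⟨S, inst, ⟨φ⟩⟩ := h
  refine ⟨S, inst, fun x => (φ x).1, fun x => (φ x).2.1, fun x y => ?_, fun s t hs ht hst => ?_⟩
  · rw [← φ.map_adj_iff]
    exact and_congr_left fun _ => φ.injective.ne_iff
  · let v : Vertex S := ⟨s, hs, t, ht, hst⟩
    exact ⟨φ.symm v, congrArg Subtype.val (φ.apply_symm_apply v)⟩

namespace IsLabeling

variable {V S : Type u} [CommSemigroupWithZero S] {G : SimpleGraph V} {m : V → S}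
  {a b c d p q s t x y w : V}

theorem mul_eq_zero (h : IsLabeling G m) (hxy : G.Adj x y) : m x * m y = 0 :=
  ((h.adj_iff x y).1 hxy).2

theorem mul_ne_zero (h : IsLabeling G m) (hne : x ≠ y) (hxy : ¬ G.Adj x y) : m x * m y ≠ 0 :=
  fun h0 => hxy ((h.adj_iff x y).2 ⟨hne, h0⟩)

theorem eq_or_adj (h : IsLabeling G m) (hxy : m x * m y = 0) : x = y ∨ G.Adj x y := by
  rw [h.adj_iff]
  tauto

/-- A neighbour `t` of `x` annihilates the product too, so a nonzero product is again a
zero-divisor. -/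
theorem exists_mul_eq (h : IsLabeling G m) (hne : m x * m y ≠ 0) (hxt : G.Adj x t) :
    ∃ z, m z = m x * m y :=
  h.exists_eq _ (m t) hne (h.ne_zero t) (by
    rw [mul_right_comm, h.mul_eq_zero hxt, zero_mul])

/-- A nonzero product would be a vertex annihilated by both `s` and `t`, hence equal or adjacent to
each, so `s` and `t` would be at distance at most `2`. -/
theorem mul_eq_zero_of_dist (h : IsLabeling G m) (hst : 2 < G.dist s t) (hsx : G.Adj s x)
    (hty : G.Adj t y) : m x * m y = 0 := by
  by_contra hne
  obtain ⟨z, hz⟩ := h.exists_mul_eq hne hsx.symm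
  have hzs : m s * m z = 0 := by rw [hz, ← mul_assoc, h.mul_eq_zero hsx, zero_mul]
  have hzt : m z * m t = 0 := by rw [hz, mul_assoc, h.mul_eq_zero hty.symm, mul_zero]
  rcases h.eq_or_adj hzs with rfl | h1 <;> rcases h.eq_or_adj hzt with rfl | h2
  · simp at hst
  · rw [SimpleGraph.dist_eq_one_iff_adj.2 h2] at hst
    omega
  · rw [SimpleGraph.dist_eq_one_iff_adj.2 h1] at hst
    omega
  · have := SimpleGraph.dist_le (.cons h1 (.cons h2 .nil) : G.Walk s t)
    simp at this
    omega

/-- The neighbor `b` of an end vertex `q` absorbs every `x` not adjacent to `b` that has a neighbor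
outside `{b, q}`. -/
theorem mul_eq_of_mem_endSet (h : IsLabeling G m) (hq : q ∈ endSet G b) (hne : x ≠ b)
    (hxb : ¬ G.Adj x b) (hxt : G.Adj x t) (htq : t ≠ q) (htb : t ≠ b) : m x * m b = m b := by
  obtain ⟨z, hz⟩ := h.exists_mul_eq (h.mul_ne_zero hne hxb) hxt
  have hqz : m q * m z = 0 := by
    rw [hz, mul_left_comm, h.mul_eq_zero hq.1.symm, mul_zero]
  have htz : m t * m z = 0 := by
    rw [hz, ← mul_assoc, h.mul_eq_zero hxt.symm, zero_mul]
  -- Being annihilated by `q`, the product is `q` or `b`; annihilation by `t` excludes `q`.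
  rcases h.eq_or_adj hqz with rfl | hadj
  · rcases h.eq_or_adj htz with e | e
    · exact absurd e htq
    · exact absurd ((adj_iff_of_mem_endSet hq).1 e.symm) htb
  · rw [← hz, (adj_iff_of_mem_endSet hq).1 hadj]

theorem adj_of_isLayered (h : IsLabeling G m) (hG : IsLayered G a b c d)
    (hw : w ∈ levelThree G c) : G.Adj a d := by
  have hw3 : G.dist c w = 3 := hw
  refine (h.adj_iff _ _).2 ⟨hG.ne_left.symm, h.mul_eq_zero_of_dist (s := c) (t := w) (by omega)
    hG.adj_left (hG.adj_levelThree w hw).symm⟩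

theorem isEndVertex_of_isLayered (h : IsLabeling G m) (hG : IsLayered G a b c d)
    (hw : w ∈ levelThree G c) : IsEndVertex G w := by
  refine Set.encard_eq_one.2 ⟨d, Set.ext fun y => ?_⟩
  rw [SimpleGraph.mem_neighborSet, Set.mem_singleton_iff]
  refine ⟨fun hwy => ?_, fun e => e ▸ (hG.adj_levelThree w hw).symm⟩
  refine (hG.eq_or_mem_levelThree hw hwy).resolve_right fun hy => ?_
  have hy3 : G.dist c y = 3 := hy
  rcases h.eq_or_adj (h.mul_eq_zero_of_dist (s := c) (t := y) (by omega) hG.adj_left hwy.symm)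
    with e | e
  · exact hG.ne_of_mem_levelThree hw e.symm
  · exact hG.not_adj_levelThree hw e

/-- Vertices of `C(a, b)` and ends at `a` or `b` are not adjacent to `d`, and the third layer is not
adjacent to `a`. This pins down the products computed below. -/
theorem eq_of_mul_eq_zero (h : IsLabeling G m) (hG : IsLayered G a b c d)
    (hxa : m x * m a = 0) (hxd : m x * m d = 0) :
    x = a ∨ x = b ∨ x = d := by
  have hda := hG.ne_left
  have hdb := hG.swap.ne_left
  rcases hG.cover x with e | e | e | hx | hx | hx | hx
  · exact .inl e
  · exact .inr (.inl e)
  · exact .inr (.inr e)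
  · rcases h.eq_or_adj hxd with e | e
    · exact .inr (.inr e)
    · exact absurd ((adj_iff_of_mem_capSet hx).1 e) (by tauto)
  · rcases h.eq_or_adj hxd with e | e
    · exact .inr (.inr e)
    · exact absurd ((adj_iff_of_mem_endSet hx).1 e) hda
  · rcases h.eq_or_adj hxd with e | e
    · exact .inr (.inr e)
    · exact absurd ((adj_iff_of_mem_endSet hx).1 e) hdb
  · rcases h.eq_or_adj hxa with e | e
    · exact .inl e
    · exact absurd e.symm (hG.not_adj_levelThree hx)

theorem mul_levelThree_left (h : IsLabeling G m) (hG : IsLayered G a b c d)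
    (hw : w ∈ levelThree G c) (hp : p ∈ endSet G a) : m w * m a = m a :=
  h.mul_eq_of_mem_endSet hp (hG.ne_of_mem_levelThree hw)
    (fun e => hG.not_adj_levelThree hw e.symm) (hG.adj_levelThree w hw).symm
    (fun e => hG.notMem_left (e ▸ hp)) hG.ne_left

theorem mul_endSet_right (h : IsLabeling G m) (hG : IsLayered G a b c d)
    (hp : p ∈ endSet G a) (hq : q ∈ endSet G b) : m p * m b = m b :=
  h.mul_eq_of_mem_endSet hq (hG.ne_of_mem_endSet hp)
    (fun e => hG.adj.ne ((adj_iff_of_mem_endSet hp).1 e).symm) hp.1.symm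
    (hG.swap.ne_of_mem_endSet hq).symm hG.adj.ne

/-- The absorption principle applied to `d`, with `w` as its end vertex. -/
theorem mul_endSet_d (h : IsLabeling G m) (hG : IsLayered G a b c d)
    (hw : w ∈ levelThree G c) (hp : p ∈ endSet G a) : m p * m d = m d :=
  h.mul_eq_of_mem_endSet ⟨hG.adj_levelThree w hw, h.isEndVertex_of_isLayered hG hw⟩
    (fun e => hG.notMem_left (e ▸ hp))
    (fun e => hG.ne_left ((adj_iff_of_mem_endSet hp).1 e)) hp.1.symm
    (hG.ne_of_mem_levelThree hw).symm hG.ne_left.symm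

/-- The product is annihilated by `a` and `d`, so it is `a`, `b` or `d`; it also fixes `b`, whereas
`a` and `d` annihilate `b`. -/
theorem mul_endSet_levelThree (h : IsLabeling G m) (hG : IsLayered G a b c d)
    (hw : w ∈ levelThree G c) (hp : p ∈ endSet G a) (hq : q ∈ endSet G b) :
    m p * m w = m b := by
  have hpw : m p * m w ≠ 0 := h.mul_ne_zero
    (fun e => hG.notMem_endSet_levelThree hw (e ▸ hp))
    (fun e => hG.ne_of_mem_levelThree hw ((adj_iff_of_mem_endSet hp).1 e))
  obtain ⟨z, hz⟩ := h.exists_mul_eq hpw hp.1.symm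
  have hza : m z * m a = 0 := by
    rw [hz, mul_right_comm, h.mul_eq_zero hp.1.symm, zero_mul]
  have hzd : m z * m d = 0 := by
    rw [hz, mul_assoc, h.mul_eq_zero (hG.adj_levelThree w hw).symm, mul_zero]
  have hzb : m z * m b = m b := by
    rw [hz, mul_assoc, h.mul_levelThree_left hG.swap hw hq, h.mul_endSet_right hG hp hq]
  rw [← hz]
  rcases h.eq_of_mul_eq_zero hG hza hzd with rfl | rfl | rfl
  · rw [h.mul_eq_zero hG.adj] at hzb
    exact absurd hzb.symm (h.ne_zero b)
  · rfl
  · rw [h.mul_eq_zero (h.adj_of_isLayered hG.swap hw).symm] at hzb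
    exact absurd hzb.symm (h.ne_zero b)

theorem mul_self_left (h : IsLabeling G m) (hG : IsLayered G a b c d)
    (hw : w ∈ levelThree G c) (hp : p ∈ endSet G a) (hq : q ∈ endSet G b) :
    m b * m b = m b := by
  nth_rw 1 [← h.mul_endSet_levelThree hG hw hp hq]
  rw [mul_assoc, h.mul_levelThree_left hG.swap hw hq, h.mul_endSet_right hG hp hq]

theorem endSet_eq_empty_or (h : IsLabeling G m) (hG : IsLayered G a b c d)
    (hw : w ∈ levelThree G c) : endSet G a = ∅ ∨ endSet G b = ∅ := by
  by_contra! hne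
  obtain ⟨⟨p, hp⟩, ⟨q, hq⟩⟩ := hne
  have had := h.adj_of_isLayered hG hw
  have hwd := (hG.adj_levelThree w hw).symm
  have hpq : m p * m q ≠ 0 := h.mul_ne_zero
    (fun e => hG.adj.ne ((adj_iff_of_mem_endSet hq).1 (e ▸ hp.1.symm)))
    (fun e => hG.swap.ne_of_mem_endSet hq ((adj_iff_of_mem_endSet hp).1 e))
  obtain ⟨z, hz⟩ := h.exists_mul_eq hpq hp.1.symm
  -- Here `w(pq) = (pw)q = bq = 0`; with `w` an end at `d`, this leaves only `pq = d`.
  have hwz : m w * m z = 0 := by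
    rw [hz, mul_comm, mul_right_comm, h.mul_endSet_levelThree hG hw hp hq,
      h.mul_eq_zero hq.1]
  have hza : m z * m a = 0 := by
    rw [hz, mul_right_comm, h.mul_eq_zero hp.1.symm, zero_mul]
  have hzd : z = d := by
    rcases h.eq_or_adj hwz with rfl | e
    · rcases h.eq_or_adj hza with e | e
      · exact absurd e (hG.ne_of_mem_levelThree hw)
      · exact absurd e.symm (hG.not_adj_levelThree hw)
    · exact (hG.adj_iff_of_mem_levelThree hw (h.isEndVertex_of_isLayered hG hw)).1 e
  subst hzd
  have hdd : m z * m z = m z := by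
    nth_rw 1 [hz]
    rw [mul_assoc, h.mul_endSet_d hG.swap hw hq, h.mul_endSet_d hG hw hp]
  have hca := h.mul_eq_zero hG.adj_left
  have hcb := h.mul_eq_zero hG.swap.adj_left
  have hcw : m c * m w ≠ 0 := by
    have hw3 : G.dist c w = 3 := hw
    refine h.mul_ne_zero (fun e => ?_) (fun e => ?_)
    · simp [e] at hw3
    · rw [SimpleGraph.dist_eq_one_iff_adj.2 e] at hw3
      omega
  -- The product `cw` is annihilated by `a`, `b` and `d`, so it is one of these and squares to zero,
  -- against idempotence.
  obtain ⟨y, hy⟩ := h.exists_mul_eq hcw hG.adj_left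
  have hya : m y * m a = 0 := by rw [hy, mul_right_comm, hca, zero_mul]
  have hyb : m y * m b = 0 := by rw [hy, mul_right_comm, hcb, zero_mul]
  have hyd : m y * m z = 0 := by rw [hy, mul_assoc, h.mul_eq_zero hwd, mul_zero]
  rcases h.eq_of_mul_eq_zero hG hya hyd with rfl | rfl | rfl
  · exact h.ne_zero y ((h.mul_self_left hG.swap hw hq hp).symm.trans hya)
  · exact h.ne_zero y ((h.mul_self_left hG hw hp hq).symm.trans hyb)
  · exact h.ne_zero y (hdd.symm.trans hyd)

end IsLabeling

end Labeling

end ZeroDivGraph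

theorem theorem3p3 {V : Type u} (G : SimpleGraph V) (hconn : G.Connected) (hdiam : G.diam = 3)
    (a b : V) (hab : G.Adj a b)
    (c₁ : V) (hc₁ : c₁ ∈ ZeroDivGraph.capSet G a b)
    (w : V) (hw : G.dist c₁ w = 3)
    (hB : (ZeroDivGraph.levelTwo G a b c₁ \
      (ZeroDivGraph.endSet G a ∪ ZeroDivGraph.endSet G b)).encard = 1) :
    (ZeroDivGraph.IsSemigroupGraph G ↔
      ((ZeroDivGraph.capSet G a b).Nonempty ∧
        (ZeroDivGraph.levelThree G c₁).Nonempty ∧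
        (∀ s ∈ ZeroDivGraph.levelThree G c₁, ZeroDivGraph.IsEndVertex G s)) ∧
      (ZeroDivGraph.endSet G a = ∅ ∨ ZeroDivGraph.endSet G b = ∅) ∧
      (∀ d ∈ ZeroDivGraph.levelTwo G a b c₁ \
        (ZeroDivGraph.endSet G a ∪ ZeroDivGraph.endSet G b), G.Adj a d ∧ G.Adj b d)) ∧
    (ZeroDivGraph.IsSemigroupGraph G ↔
      ∃ C U V' W : Type u, Nonempty C ∧ Nonempty W ∧ IsEmpty V' ∧
        ∃ φ : G ≃g ZeroDivGraph.modelGraph C U V' W,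
          (φ a = .a ∧ φ b = .b) ∨ (φ a = .b ∧ φ b = .a)) := by
  obtain ⟨d, hd⟩ := Set.encard_eq_one.1 hB
  have hG := exists_isLayered hconn hdiam hab hc₁ hd
  rw [hd]
  have hnec : Nonempty (capSet G a b) := ⟨⟨c₁, hc₁⟩⟩
  have hnec' : Nonempty (capSet G b a) := ⟨⟨c₁, hG.swap.mem_capSet⟩⟩
  have hnew : Nonempty (levelThree G c₁) := ⟨⟨w, hw⟩⟩
  have hcycle : ∀ {P Q R : Prop}, (P → Q) → (Q → R) → (R → P) → (P ↔ Q) ∧ (P ↔ R) := by tauto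
  refine hcycle (fun h => ?_) ?_ ?_
  · obtain ⟨S, inst, m, hm⟩ := h.exists_isLabeling
    refine ⟨⟨⟨c₁, hc₁⟩, ⟨w, hw⟩, fun s hs => hm.isEndVertex_of_isLayered hG hs⟩,
      hm.endSet_eq_empty_or hG hw, ?_⟩
    rintro _ rfl
    exact ⟨hm.adj_of_isLayered hG hw, hm.adj_of_isLayered hG.swap hw⟩
  · rintro ⟨⟨-, -, hW⟩, hT, hadj⟩
    obtain ⟨had, hbd⟩ := hadj d rfl
    rcases hT with hT | hT
    -- The model has ends only at its own `a`, so when `T_a` is empty the roles of `a` and `b` are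
    -- interchanged.
    · obtain ⟨φ, h1, h2⟩ := hG.swap.exists_iso hT hW hbd had
      exact ⟨_, _, _, _, hnec', hnew, inferInstance, φ, .inr ⟨h2, h1⟩⟩
    · obtain ⟨φ, h1, h2⟩ := hG.exists_iso hT hW had hbd
      exact ⟨_, _, _, _, hnec, hnew, inferInstance, φ, .inl ⟨h1, h2⟩⟩
  · rintro ⟨C, U, V', W, hC, hW, hV', φ, -⟩
    exact isSemigroupGraph_modelGraph.of_iso φ
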